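/- Let $c_0$ be the Banach space of complex sequences $z=(z_j)_{j\ge 1}$ tending to $0$, with the norm $\|z\|=\sup_j|z_j|$, and let $\mathbf B$ be its open unit ball. Let $A^+(\mathbb T^\infty)$ be the algebra of all functions $f:\mathbf B\to\mathbb C$ of the form $f(z)=\sum_{\alpha}a_\alpha z^\alpha$, where $\alpha$ ranges over the finitely supported sequences of non-negative integers, $z^\alpha=\prod_j z_j^{\alpha_j}$ and $\|f\|:=\sum_\alpha|a_\alpha|<\infty$. Let $\phi=(\phi_j)_{j\ge 1}:\mathbf B\to\mathbf B$ be an analytic map such that $C_\phi: f\mapsto f\circ\phi$ maps $A^+(\mathbb T^\infty)$ into itself. Then: (a) If there are a permutation $\sigma$ of $\mathbb N=\{1,2,\dots\}$ and complex numbers $\epsilon_j$ with $|\epsilon_j|=1$ such that $\phi(z)=(\epsilon_j z_{\sigma(j)})_{j\ge 1}$ for all $z\in\mathbf B$, then $C_\phi$ is an automorphism of the algebra $A^+(\mathbb T^\infty)$, and it is isometric: $\|C_\phi f\|=\|f\|$ for all $f$. (b) If $C_\phi$ is an automorphism of the algebra $A^+(\mathbb T^\infty)$ and if, moreover, for each $k$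 there are an integer $d_k\ge 1$ and a continuous function $u_k:\mathbf B\to\mathbb C$ with $u_k(0)\ne 0$ such that $\phi_k(z)=z_k^{d_k}u_k(z)$ for all $z\in\mathbf B$, then there are complex numbers $\epsilon_j$ with $|\epsilon_j|=1$ such that $\phi(z)=(\epsilon_j z_j)_{j\ge 1}$ for all $z\in\mathbf B$. -/

import Mathlib

namespace WienerPolydisc

open scoped ZeroAtInfty

/-- The Banach space `c₀` of complex sequences tending to zero, with the supremum norm
(on the discrete space `ℕ`, "vanishing at infinity" means "tending to `0`"). -/
abbrev C0 : Type := C₀(ℕ, ℂ)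

/-- The open unit ball of `c₀`. -/
abbrev B : Set C0 := Metric.ball (0 : C0) 1

/-- The monomial `z ^ α = ∏ j, z j ^ α j`, for a finitely supported multi-index `α`. -/
noncomputable def monom (α : ℕ →₀ ℕ) (z : C0) : ℂ := α.prod fun j m => z j ^ m

/-- `a` is a family of coefficients of an absolutely convergent Taylor series with sum `f`:
`∑ |a α| < ∞` and `f z = ∑ a α z ^ α` on the ball. -/
structure IsExpansion (a : (ℕ →₀ ℕ) → ℂ) (f : B → ℂ) : Prop where
  summable : Summable fun α => ‖a α‖
  hasSum : ∀ z : B, HasSum (fun α => a α * monom α z) (f z)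

theorem mem_B_iff {z : C0} : z ∈ B ↔ ‖z‖ < 1 := mem_ball_zero_iff

theorem norm_apply_lt_one (z : B) (j : ℕ) : ‖(z : C0) j‖ < 1 :=
  lt_of_le_of_lt (BoundedContinuousFunction.norm_coe_le_norm (z : C0).toBCF j)
    (mem_B_iff.1 z.2)

theorem norm_monom_le_one (α : ℕ →₀ ℕ) (z : B) : ‖monom α z‖ ≤ 1 := by
  unfold monom Finsupp.prod
  rw [norm_prod]
  refine Finset.prod_le_one (fun _ _ => norm_nonneg _) fun j _ => ?_
  rw [norm_pow]
  exact pow_le_one₀ (norm_nonneg _) (norm_apply_lt_one z j).le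

theorem monom_zero (z : C0) : monom 0 z = 1 := Finsupp.prod_zero_index

theorem monom_add (α β : ℕ →₀ ℕ) (z : C0) : monom (α + β) z = monom α z * monom β z :=
  Finsupp.prod_add_index' (fun _ => pow_zero _) fun _ _ _ => pow_add _ _ _

theorem summable_norm_mul_monom {a : (ℕ →₀ ℕ) → ℂ} (ha : Summable fun α => ‖a α‖) (z : B) :
    Summable fun α => ‖a α * monom α z‖ := by
  refine ha.of_nonneg_of_le (fun _ => norm_nonneg _) fun α => ?_
  rw [norm_mul]
  exact mul_le_of_le_one_right (norm_nonneg _) (norm_monom_le_one α z)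

theorem IsExpansion.const (c : ℂ) : IsExpansion (Pi.single 0 c) fun _ => c where
  summable := by
    refine summable_of_ne_finset_zero (s := {0}) fun α hα => ?_
    have h : α ≠ 0 := by simpa using hα
    simp [h]
  hasSum z := by
    have h := hasSum_single (f := fun α : ℕ →₀ ℕ => (Pi.single 0 c : (ℕ →₀ ℕ) → ℂ) α * monom α z)
      0 fun α hα => by simp [hα]
    simpa [monom_zero] using h

theorem IsExpansion.add {a b : (ℕ →₀ ℕ) → ℂ} {f g : B → ℂ} (hf : IsExpansion a f)
    (hg : IsExpansion b g) : IsExpansion (a + b) (f + g) where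
  summable := (hf.summable.add hg.summable).of_nonneg_of_le (fun _ => norm_nonneg _)
    fun α => norm_add_le (a α) (b α)
  hasSum z := by simpa [add_mul] using (hf.hasSum z).add (hg.hasSum z)

/-- The coefficients of the product of two power series. -/
noncomputable def conv (a b : (ℕ →₀ ℕ) → ℂ) (α : ℕ →₀ ℕ) : ℂ :=
  ∑ p ∈ Finset.HasAntidiagonal.antidiagonal α, a p.1 * b p.2

theorem summable_norm_conv {a b : (ℕ →₀ ℕ) → ℂ} (ha : Summable fun α => ‖a α‖)
    (hb : Summable fun α => ‖b α‖) : Summable fun α => ‖conv a b α‖ := by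
  have h : Summable fun α : ℕ →₀ ℕ => ∑ p ∈ Finset.HasAntidiagonal.antidiagonal α,
      ‖a p.1‖ * ‖b p.2‖ :=
    summable_sum_mul_antidiagonal_of_summable_mul (f := fun α => ‖a α‖) (g := fun α => ‖b α‖)
      (Summable.mul_of_nonneg ha hb (fun _ => norm_nonneg _) fun _ => norm_nonneg _)
  refine Summable.of_nonneg_of_le (fun _ => norm_nonneg _) (fun α => ?_) h
  unfold conv
  refine (norm_sum_le _ _).trans (Finset.sum_le_sum fun p _ => ?_)
  rw [norm_mul]

theorem conv_mul_monom (a b : (ℕ →₀ ℕ) → ℂ) (z : C0) (α : ℕ →₀ ℕ) :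
    conv a b α * monom α z =
      conv (fun α => a α * monom α z) (fun α => b α * monom α z) α := by
  unfold conv
  rw [Finset.sum_mul]
  refine Finset.sum_congr rfl fun p hp => ?_
  have hp' : p.1 + p.2 = α := Finset.HasAntidiagonal.mem_antidiagonal.1 hp
  rw [← hp', monom_add, mul_mul_mul_comm]

theorem hasSum_conv {a b : (ℕ →₀ ℕ) → ℂ} (ha : Summable fun α => ‖a α‖)
    (hb : Summable fun α => ‖b α‖) : HasSum (conv a b) ((∑' α, a α) * ∑' α, b α) := by
  have hs : Summable fun p : (ℕ →₀ ℕ) × (ℕ →₀ ℕ) => a p.1 * b p.2 :=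
    summable_mul_of_summable_norm ha hb
  rw [Summable.tsum_mul_tsum_eq_tsum_sum_antidiagonal ha.of_norm hb.of_norm hs]
  exact (summable_sum_mul_antidiagonal_of_summable_mul hs).hasSum

theorem IsExpansion.mul {a b : (ℕ →₀ ℕ) → ℂ} {f g : B → ℂ} (hf : IsExpansion a f)
    (hg : IsExpansion b g) : IsExpansion (conv a b) (f * g) where
  summable := summable_norm_conv hf.summable hg.summable
  hasSum z := by
    have h := hasSum_conv (summable_norm_mul_monom hf.summable z)
      (summable_norm_mul_monom hg.summable z)
    rw [(hf.hasSum z).tsum_eq, (hg.hasSum z).tsum_eq] at h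
    have e : (fun α => conv a b α * monom α z) =
        conv (fun α => a α * monom α z) (fun α => b α * monom α z) :=
      funext fun α => conv_mul_monom a b z α
    rw [e]
    exact h

/-- The Wiener algebra in countably many variables: the algebra (for the pointwise operations)
of all functions on the ball that are sums of absolutely convergent Taylor series
`∑ a α z ^ α` with `∑ |a α| < ∞`. -/
def wienerAlgebra : Subalgebra ℂ (B → ℂ) where
  carrier := {f | ∃ a, IsExpansion a f}
  mul_mem' := by
    rintro f g ⟨a, ha⟩ ⟨b, hb⟩
    exact ⟨_, ha.mul hb⟩
  add_mem' := by
    rintro f g ⟨a, ha⟩ ⟨b, hb⟩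
    exact ⟨_, ha.add hb⟩
  algebraMap_mem' c := ⟨_, IsExpansion.const c⟩

/-- The Taylor coefficients of an element of the Wiener algebra (they are unique, see
`coeff_eq`). -/
noncomputable def coeff (f : wienerAlgebra) : (ℕ →₀ ℕ) → ℂ := Classical.choose f.2

/-- The norm of the Wiener algebra, `‖f‖ = ∑ |a α|`. -/
noncomputable def wienerNorm (f : wienerAlgebra) : ℝ := ∑' α, ‖coeff f α‖

theorem isExpansion_coeff (f : wienerAlgebra) : IsExpansion (coeff f) f :=
  Classical.choose_spec f.2

/-- The positive integer `∏ j, p j ^ α j`, where `p 0 < p 1 < ...` are the primes. -/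
noncomputable def primeProd (α : ℕ →₀ ℕ) : ℕ := α.prod fun j m => Nat.nth Nat.Prime j ^ m

theorem primeProd_injective : Function.Injective primeProd := by
  have hinj : Function.Injective (Nat.nth Nat.Prime) := Nat.nth_injective Nat.infinite_setOfPred_prime
  have h : ∀ α, (primeProd α).factorization = α.mapDomain (Nat.nth Nat.Prime) := by
    intro α
    have h1 : primeProd α = (α.mapDomain (Nat.nth Nat.Prime)).prod fun p m => p ^ m :=
      (Finsupp.prod_mapDomain_index_inj hinj).symm
    rw [h1]
    refine Nat.prod_pow_factorization_eq_self fun p hp => ?_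
    obtain ⟨j, -, rfl⟩ := Finset.mem_image.1 (Finsupp.mapDomain_support hp)
    exact Nat.prime_nth_prime j
  intro α β hαβ
  exact Finsupp.mapDomain_injective hinj ((h α).symm.trans ((congrArg _ hαβ).trans (h β)))

theorem primeProd_ne_zero (α : ℕ →₀ ℕ) : primeProd α ≠ 0 :=
  Finset.prod_ne_zero_iff.2 fun j _ => pow_ne_zero _ (Nat.prime_nth_prime j).ne_zero

/-- The point `(p j ^ (-x))` of `c₀`, for `x > 0`. -/
theorem exists_primePoint {x : ℝ} (hx : 0 < x) :
    ∃ z : B, ∀ j, (z : C0) j = (Nat.nth Nat.Prime j : ℂ) ^ (-(x : ℂ)) := by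
  have hn : ∀ j, ‖(Nat.nth Nat.Prime j : ℂ) ^ (-(x : ℂ))‖ = (Nat.nth Nat.Prime j : ℝ) ^ (-x) := by
    intro j
    rw [Complex.norm_natCast_cpow_of_pos (Nat.prime_nth_prime j).pos]
    simp
  have ht : Filter.Tendsto (fun j => (Nat.nth Nat.Prime j : ℂ) ^ (-(x : ℂ)))
      (Filter.cocompact ℕ) (nhds 0) := by
    rw [Filter.cocompact_eq_cofinite, Nat.cofinite_eq_atTop, tendsto_zero_iff_norm_tendsto_zero]
    simp only [hn]
    refine (tendsto_rpow_neg_atTop hx).comp (tendsto_natCast_atTop_atTop.comp ?_)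
    exact (Nat.nth_strictMono Nat.infinite_setOfPred_prime).tendsto_atTop
  let z : C0 := ⟨⟨fun j => (Nat.nth Nat.Prime j : ℂ) ^ (-(x : ℂ)), continuous_of_discreteTopology⟩,
    ht⟩
  have hz : ‖z‖ ≤ (2 : ℝ) ^ (-x) := by
    refine (BoundedContinuousFunction.norm_le (f := z.toBCF) (by positivity)).2 fun j => ?_
    refine (hn j).le.trans ?_
    refine Real.rpow_le_rpow_of_nonpos (by norm_num) ?_ (by linarith)
    exact_mod_cast (Nat.prime_nth_prime j).two_le
  refine ⟨⟨z, mem_B_iff.2 (hz.trans_lt ?_)⟩, fun j => rfl⟩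
  exact Real.rpow_lt_one_of_one_lt_of_neg (by norm_num) (by linarith)

theorem monom_primePoint {x : ℝ} {z : C0}
    (hz : ∀ j, z j = (Nat.nth Nat.Prime j : ℂ) ^ (-(x : ℂ))) (α : ℕ →₀ ℕ) :
    monom α z = (primeProd α : ℂ) ^ (-(x : ℂ)) := by
  let g : ℕ →* ℂ :=
    { toFun := fun n => (n : ℂ) ^ (-(x : ℂ))
      map_one' := by simp
      map_mul' := fun m n => by
        rw [Nat.cast_mul, Complex.natCast_mul_natCast_cpow] }
  have h : g (primeProd α) = α.prod fun j m => g (Nat.nth Nat.Prime j) ^ m := by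
    unfold primeProd Finsupp.prod
    rw [map_prod]
    exact Finset.prod_congr rfl fun j _ => map_pow _ _ _
  refine Eq.trans ?_ h.symm
  unfold monom Finsupp.prod
  exact Finset.prod_congr rfl fun j _ => congrArg (· ^ α j) (hz j)

/-- The Taylor coefficients of a function on the ball are unique. -/
theorem IsExpansion.unique {a b : (ℕ →₀ ℕ) → ℂ} {f : B → ℂ} (ha : IsExpansion a f)
    (hb : IsExpansion b f) : a = b := by
  have aux : ∀ {a : (ℕ →₀ ℕ) → ℂ}, IsExpansion a f →
      LSeries.abscissaOfAbsConv (Function.extend primeProd a 0) < ⊤ ∧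
      ∀ x : ℝ, 0 < x → ∀ z : B, (∀ j, (z : C0) j = (Nat.nth Nat.Prime j : ℂ) ^ (-(x : ℂ))) →
        LSeries (Function.extend primeProd a 0) x = f z := by
    intro a ha
    have hs : ∀ x : ℝ, 0 < x → ∀ z : B,
        (∀ j, (z : C0) j = (Nat.nth Nat.Prime j : ℂ) ^ (-(x : ℂ))) →
        HasSum (LSeries.term (Function.extend primeProd a 0) x) (f z) := by
      intro x hx z hz
      refine (primeProd_injective.hasSum_iff ?_).1 ?_
      · intro n hn
        have h0 : Function.extend primeProd a 0 n = 0 :=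
          Function.extend_apply' _ _ _ fun ⟨α, h⟩ => hn ⟨α, h⟩
        rcases eq_or_ne n 0 with rfl | h
        · simp
        · simp [LSeries.term_of_ne_zero h, h0]
      · have hfun : LSeries.term (Function.extend primeProd a 0) x ∘ primeProd =
            fun α => a α * monom α z := by
          funext α
          rw [Function.comp_apply, LSeries.term_of_ne_zero (primeProd_ne_zero α),
            primeProd_injective.extend_apply, monom_primePoint hz, Complex.cpow_neg,
            div_eq_mul_inv]
        rw [hfun]
        exact ha.hasSum z
    refine ⟨?_, fun x hx z hz => (hs x hx z hz).tsum_eq⟩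
    obtain ⟨z, hz⟩ := exists_primePoint one_pos
    refine (LSeriesSummable.abscissaOfAbsConv_le (s := ((1 : ℝ) : ℂ)) ?_).trans_lt ?_
    · exact (hs 1 one_pos z hz).summable
    · exact EReal.coe_lt_top _
  have hA := aux ha
  have hB := aux hb
  funext α
  have h := LSeries.eq_of_LSeries_eventually_eq hA.1 hB.1 ?_ (primeProd_ne_zero α)
  · rwa [primeProd_injective.extend_apply, primeProd_injective.extend_apply] at h
  · filter_upwards [Filter.eventually_gt_atTop 0] with x hx
    obtain ⟨z, hz⟩ := exists_primePoint hx
    rw [hA.2 x hx z hz, hB.2 x hx z hz]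

theorem coeff_eq (f : wienerAlgebra) {a : (ℕ →₀ ℕ) → ℂ} (ha : IsExpansion a f) : coeff f = a :=
  (isExpansion_coeff f).unique ha

/-- `C_φ` maps the Wiener algebra into itself: `f ∘ φ` belongs to it whenever `f` does. -/
def MapsWienerAlgebra (φ : B → B) : Prop := ∀ f ∈ wienerAlgebra, f ∘ φ ∈ wienerAlgebra

/-- The composition operator `C_φ f = f ∘ φ` on the Wiener algebra. -/
def compOp (φ : B → B) (h : MapsWienerAlgebra φ) : wienerAlgebra →ₐ[ℂ] wienerAlgebra where
  toFun f := ⟨f.1 ∘ φ, h f.1 f.2⟩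
  map_one' := rfl
  map_mul' _ _ := rfl
  map_zero' := rfl
  map_add' _ _ := rfl
  commutes' _ := rfl

/-- An endomorphism of the Wiener algebra is an automorphism if it is an algebra isomorphism of
the Wiener algebra onto itself. -/
def IsAutomorphism (T : wienerAlgebra →ₐ[ℂ] wienerAlgebra) : Prop :=
  ∃ e : wienerAlgebra ≃ₐ[ℂ] wienerAlgebra, (e : wienerAlgebra →ₐ[ℂ] wienerAlgebra) = T

/-- An endomorphism of the Wiener algebra is isometric if it preserves the norm. -/
def IsIsometric (T : wienerAlgebra →ₐ[ℂ] wienerAlgebra) : Prop :=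
  ∀ f, wienerNorm (T f) = wienerNorm f

end WienerPolydisc

/-! For (a), a weighted permutation of the variables permutes the monomials up to unimodular
factors. Hence `C_φ` permutes the Taylor coefficients up to such factors, which preserves `∑ |a α|`
and can be undone.

For (b), let `T` be the inverse of `C_φ`. Since `coord k - c` is invertible when `|c| > 1`, `T
(coord k)` is bounded by one (`norm_map_coord_le_one`). The factor `z j ^ d j` in `φ j` makes `φ`
fix the origin and preserve each coordinate axis. On the `k`-th axis, `T (coord k)` is a left
inverse of `φ k`, so the Schwarz lemma applied to both gives `|φ k| = |w|` at `w e_k`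
(`norm_apply_smul_basisVec`). The derivative there at the origin, `0 ^ (d k - 1) * u k 0`, is
therefore unimodular, which forces `d k = 1` and `|u k 0| = 1`.

The equality case of the Schwarz lemma now gives `φ k z = u k 0 * z k` wherever `|z k| = ‖z‖`. These
points include a nonempty open set, and the identity theorem extends the formula to the ball. -/

namespace WienerPolydisc

open Metric Filter Topology

/-! ### Coordinates and basis vectors of `c₀` -/

/-- The `k`-th coordinate functional on `c₀`. -/
noncomputable def coordCLM (k : ℕ) : C0 →L[ℂ] ℂ :=
  LinearMap.mkContinuous
    { toFun := fun z => z k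
      map_add' := fun _ _ => rfl
      map_smul' := fun _ _ => rfl } 1 fun z => by
    rw [one_mul]
    exact BoundedContinuousFunction.norm_coe_le_norm z.toBCF k

theorem norm_apply_le (z : C0) (k : ℕ) : ‖z k‖ ≤ ‖z‖ :=
  BoundedContinuousFunction.norm_coe_le_norm z.toBCF k

theorem norm_le_of_forall {z : C0} {r : ℝ} (hr : 0 ≤ r) (h : ∀ j, ‖z j‖ ≤ r) : ‖z‖ ≤ r :=
  (BoundedContinuousFunction.norm_le (f := z.toBCF) hr).2 h

/-- The `k`-th vector of the canonical basis of `c₀`. -/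
noncomputable def basisVec (k : ℕ) : C0 where
  toFun := Pi.single k 1
  continuous_toFun := continuous_of_discreteTopology
  zero_at_infty' := by
    rw [Filter.cocompact_eq_cofinite]
    refine tendsto_const_nhds.congr' ?_
    filter_upwards [(Set.finite_singleton k).compl_mem_cofinite] with j hj
    have : j ≠ k := hj
    simp [this]

theorem basisVec_apply (k j : ℕ) : basisVec k j = (Pi.single k 1 : ℕ → ℂ) j := rfl

theorem basisVec_self (k : ℕ) : basisVec k k = 1 := by simp [basisVec_apply]

theorem basisVec_of_ne {k j : ℕ} (h : j ≠ k) : basisVec k j = 0 := by simp [basisVec_apply, h]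

theorem norm_basisVec (k : ℕ) : ‖basisVec k‖ = 1 := by
  refine le_antisymm (norm_le_of_forall zero_le_one fun j => ?_) ?_
  · rcases eq_or_ne j k with rfl | h
    · simp [basisVec_self]
    · simp [basisVec_of_ne h]
  · simpa [basisVec_self] using norm_apply_le (basisVec k) k

theorem eq_smul_basisVec {z : C0} {k : ℕ} (h : ∀ j, j ≠ k → z j = 0) : z = z k • basisVec k := by
  ext j
  rw [ZeroAtInftyContinuousMap.smul_apply]
  rcases eq_or_ne j k with rfl | hj
  · simp [basisVec_self]
  · simp [basisVec_of_ne hj, h j hj]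

theorem smul_mem_B {v : C0} (hv : ‖v‖ = 1) {w : ℂ} (hw : ‖w‖ < 1) : w • v ∈ B := by
  rw [mem_B_iff, norm_smul, hv, mul_one]
  exact hw

theorem zero_mem_B : (0 : C0) ∈ B := mem_ball_self one_pos

theorem monom_single (k n : ℕ) (z : C0) : monom (Finsupp.single k n) z = z k ^ n :=
  Finsupp.prod_single_index (pow_zero _)

/-! ### Coordinate functions, their spectrum, and restrictions to complex lines -/

theorem isExpansion_extend_single {b : ℕ → ℂ} (hb : Summable fun n => ‖b n‖) {k : ℕ} {f : B → ℂ}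
    (h : ∀ z : B, HasSum (fun n => b n * (z : C0) k ^ n) (f z)) :
    IsExpansion (Function.extend (Finsupp.single k) b 0) f := by
  have hinj : Function.Injective (Finsupp.single k : ℕ → ℕ →₀ ℕ) := Finsupp.single_injective k
  have h0 : ∀ α, α ∉ Set.range (Finsupp.single k : ℕ → ℕ →₀ ℕ) →
      Function.extend (Finsupp.single k) b 0 α = 0 := fun α hα =>
    Function.extend_apply' _ _ _ hα
  constructor
  · refine (hinj.summable_iff fun α hα => by simp [h0 α hα]).1 ?_
    simpa only [Function.comp_def, hinj.extend_apply] using hb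
  · intro z
    refine (hinj.hasSum_iff fun α hα => by simp [h0 α hα]).1 ?_
    simpa only [Function.comp_def, hinj.extend_apply, monom_single] using h z

/-- The coordinate function `z ↦ z k`, as an element of the Wiener algebra. -/
noncomputable def coord (k : ℕ) : wienerAlgebra :=
  ⟨fun z => (z : C0) k, _, isExpansion_extend_single (b := Pi.single 1 1) (k := k)
    (summable_of_ne_finset_zero (s := {1}) fun n hn => by
      have : n ≠ 1 := by simpa using hn
      simp [this])
    fun z => by
      simpa using hasSum_single (f := fun n => (Pi.single 1 1 : ℕ → ℂ) n * (z : C0) k ^ n) 1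
        fun n hn => by simp [hn]⟩

/-- The inverse is the geometric series `-c⁻¹ ∑ (z k / c) ^ n`, whose coefficients are absolutely
summable. Being a unit is purely algebraic, so endomorphisms respect it without any continuity. -/
theorem isUnit_coord_sub {k : ℕ} {c : ℂ} (hc : 1 < ‖c‖) :
    IsUnit (coord k - algebraMap ℂ wienerAlgebra c) := by
  have hc0 : c ≠ 0 := norm_pos_iff.1 (one_pos.trans hc)
  have hinv : ‖c⁻¹‖ < 1 := by
    rw [norm_inv]
    exact inv_lt_one_of_one_lt₀ hc
  have hne : ∀ z : B, (z : C0) k - c ≠ 0 := fun z h => by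
    have := norm_apply_lt_one z k
    rw [sub_eq_zero.1 h] at this
    exact lt_asymm hc this
  have hmem : (fun z : B => ((z : C0) k - c)⁻¹) ∈ wienerAlgebra := by
    refine ⟨_, isExpansion_extend_single (b := fun n => -c⁻¹ * c⁻¹ ^ n) (k := k) ?_ fun z => ?_⟩
    · simp only [norm_mul, norm_pow]
      exact (summable_geometric_of_lt_one (norm_nonneg _) hinv).mul_left _
    · have hz : ‖c⁻¹ * (z : C0) k‖ < 1 := by
        rw [norm_mul]
        exact mul_lt_one_of_nonneg_of_lt_one_left (norm_nonneg _) hinv (norm_apply_lt_one z k).le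
      have h := (hasSum_geometric_of_norm_lt_one hz).mul_left (-c⁻¹)
      have e : -c⁻¹ * (1 - c⁻¹ * (z : C0) k)⁻¹ = ((z : C0) k - c)⁻¹ := by
        rw [neg_inv, ← mul_inv]
        congr 1
        field_simp
        ring
      rw [e] at h
      simpa only [mul_pow, mul_assoc] using h
  refine IsUnit.of_mul_eq_one ⟨_, hmem⟩ (Subtype.ext (funext fun z => ?_))
  exact mul_inv_cancel₀ (hne z)

/-- An algebra endomorphism of the Wiener algebra sends coordinates to functions bounded by
one. -/
theorem norm_map_coord_le_one (T : wienerAlgebra →ₐ[ℂ] wienerAlgebra) (k : ℕ) (z : B) :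
    ‖(T (coord k)).1 z‖ ≤ 1 := by
  by_contra! hc
  -- With `c` the value of `T (coord k)` at `z`, the image of this unit would be a unit vanishing at
  -- `z`.
  have hu := (isUnit_coord_sub (k := k) hc).map T
  rw [map_sub, AlgHom.commutes] at hu
  obtain ⟨g, hg⟩ := hu.exists_right_inv
  have h := congrFun (congrArg Subtype.val hg) z
  have h0 : ((T (coord k)).1 z - (T (coord k)).1 z) * g.1 z = 1 := h
  simp at h0

theorem differentiable_monom_smul (α : ℕ →₀ ℕ) (v : C0) :
    Differentiable ℂ fun w : ℂ => monom α (w • v) := by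
  unfold monom Finsupp.prod
  simp only [ZeroAtInftyContinuousMap.smul_apply, smul_eq_mul]
  fun_prop

/-- Elements of the Wiener algebra are holomorphic on the complex lines through the origin. -/
theorem exists_differentiableOn_line (f : wienerAlgebra) {v : C0} (hv : ‖v‖ = 1) :
    ∃ h : ℂ → ℂ, DifferentiableOn ℂ h (ball 0 1) ∧
      ∀ (w : ℂ) (hw : ‖w‖ < 1), h w = f.1 ⟨w • v, smul_mem_B hv hw⟩ := by
  refine ⟨fun w => ∑' α, coeff f α * monom α (w • v), ?_, fun w hw => ?_⟩
  · refine Complex.differentiableOn_tsum_of_summable_norm (isExpansion_coeff f).summable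
      (fun α => ((differentiable_monom_smul α v).const_mul _).differentiableOn) isOpen_ball
      fun α w hw => ?_
    rw [norm_mul]
    exact mul_le_of_le_one_right (norm_nonneg _)
      (norm_monom_le_one α ⟨w • v, smul_mem_B hv (mem_ball_zero_iff.1 hw)⟩)
  · exact ((isExpansion_coeff f).hasSum ⟨w • v, smul_mem_B hv hw⟩).tsum_eq

/-! ### Weighted permutations of the coordinates -/

/-- The factor `ε ^ α` by which `z ↦ (ε j * z j)` multiplies the monomial `z ^ α`. -/
noncomputable def multiplier (ε : ℕ → ℂ) (α : ℕ →₀ ℕ) : ℂ := α.prod fun j m => ε j ^ m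

theorem norm_multiplier {ε : ℕ → ℂ} (hε : ∀ j, ‖ε j‖ = 1) (α : ℕ →₀ ℕ) :
    ‖multiplier ε α‖ = 1 := by
  unfold multiplier Finsupp.prod
  rw [norm_prod]
  exact Finset.prod_eq_one fun j _ => by rw [norm_pow, hε, one_pow]

theorem monom_of_forall_apply_eq {σ : Equiv.Perm ℕ} {ε : ℕ → ℂ} {z y : C0}
    (h : ∀ j, y j = ε j * z (σ j)) (α : ℕ →₀ ℕ) :
    monom α y = multiplier ε α * monom (Finsupp.equivMapDomain σ α) z := by
  unfold monom multiplier
  rw [Finsupp.prod_equivMapDomain, ← Finsupp.prod_mul]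
  exact Finsupp.prod_congr fun j _ => by rw [h, mul_pow]

section WeightedPermutation

variable {σ : Equiv.Perm ℕ} {ε : ℕ → ℂ} {φ : B → B}

/-- Composition with `z ↦ (ε j * z (σ j))` permutes the Taylor coefficients, up to unimodular
factors. -/
theorem IsExpansion.comp_weightedPerm (hε : ∀ j, ‖ε j‖ = 1)
    (hφ : ∀ z : B, ∀ j, (φ z : C0) j = ε j * (z : C0) (σ j)) {b : (ℕ →₀ ℕ) → ℂ} {f g : B → ℂ}
    (hg : ∀ z, g z = f (φ z))
    (hf : IsExpansion (fun α => b (Finsupp.equivMapDomain σ α) * (multiplier ε α)⁻¹) f) :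
    IsExpansion b g := by
  have hne : ∀ α, multiplier ε α ≠ 0 := fun α =>
    norm_ne_zero_iff.1 (by rw [norm_multiplier hε]; exact one_ne_zero)
  let τ : (ℕ →₀ ℕ) ≃ (ℕ →₀ ℕ) := Finsupp.equivCongrLeft σ
  have hτ : ∀ α, τ α = Finsupp.equivMapDomain σ α := fun _ => rfl
  constructor
  · refine (τ.summable_iff).1 (hf.summable.congr fun α => ?_)
    rw [norm_mul, norm_inv, norm_multiplier hε, inv_one, mul_one, Function.comp_apply, hτ]
  · intro z
    refine (τ.hasSum_iff).1 ?_
    rw [hg]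
    convert hf.hasSum (φ z) using 2 with α
    rw [Function.comp_apply, hτ, monom_of_forall_apply_eq (hφ z), mul_assoc,
      inv_mul_cancel_left₀ (hne α)]

theorem isIsometric_compOp_of_weightedPerm (hε : ∀ j, ‖ε j‖ = 1)
    (hφ : ∀ z : B, ∀ j, (φ z : C0) j = ε j * (z : C0) (σ j)) (hC : MapsWienerAlgebra φ) :
    IsIsometric (compOp φ hC) := by
  intro f
  have hne : ∀ α, multiplier ε α ≠ 0 := fun α =>
    norm_ne_zero_iff.1 (by rw [norm_multiplier hε]; exact one_ne_zero)
  let τ : (ℕ →₀ ℕ) ≃ (ℕ →₀ ℕ) := Finsupp.equivCongrLeft σ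
  -- Composition moves the coefficient at `α` to `τ α` and multiplies it by `ε ^ α`.
  let b : (ℕ →₀ ℕ) → ℂ := fun β => coeff f (τ.symm β) * multiplier ε (τ.symm β)
  have hb : (fun α => b (Finsupp.equivMapDomain σ α) * (multiplier ε α)⁻¹) = coeff f := by
    funext α
    have : τ.symm (Finsupp.equivMapDomain σ α) = α := τ.symm_apply_apply α
    simp only [b, this]
    exact mul_inv_cancel_right₀ (hne α) _
  have hexp : IsExpansion b (compOp φ hC f).1 :=
    IsExpansion.comp_weightedPerm hε hφ (fun _ => rfl) (hb ▸ isExpansion_coeff f)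
  unfold wienerNorm
  rw [coeff_eq _ hexp]
  simp only [b, norm_mul, norm_multiplier hε, mul_one]
  exact τ.symm.tsum_eq fun α => ‖coeff f α‖

theorem isAutomorphism_compOp_of_weightedPerm (hε : ∀ j, ‖ε j‖ = 1)
    (hφ : ∀ z : B, ∀ j, (φ z : C0) j = ε j * (z : C0) (σ j)) (hC : MapsWienerAlgebra φ) :
    IsAutomorphism (compOp φ hC) := by
  have hinj : Function.Injective (compOp φ hC) := by
    refine (injective_iff_map_eq_zero _).2 fun f hf => ?_
    have h := isIsometric_compOp_of_weightedPerm hε hφ hC f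
    have h0 : coeff (0 : wienerAlgebra) = 0 := by
      rw [← Pi.single_zero (M := fun _ : ℕ →₀ ℕ => ℂ) 0]
      exact coeff_eq _ (IsExpansion.const 0)
    rw [hf] at h
    simp only [wienerNorm, h0, Pi.zero_apply, norm_zero, tsum_zero] at h
    have hz : (fun α => ‖coeff f α‖) = 0 :=
      ((isExpansion_coeff f).summable.hasSum_iff.2 h.symm |> (hasSum_zero_iff_of_nonneg
        fun _ => norm_nonneg _).1)
    refine Subtype.ext (funext fun z => ((isExpansion_coeff f).hasSum z).unique ?_)
    have hα : ∀ α, coeff f α = 0 := fun α => norm_eq_zero.1 (congrFun hz α)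
    simp only [hα, zero_mul]
    exact hasSum_zero
  have hsurj : Function.Surjective (compOp φ hC) := by
    intro g
    -- The coefficients of the preimage: undo the permutation and divide by `ε ^ α`.
    let a : (ℕ →₀ ℕ) → ℂ := fun α => coeff g (Finsupp.equivMapDomain σ α) * (multiplier ε α)⁻¹
    have ha : Summable fun α => ‖a α‖ := by
      simp only [a, norm_mul, norm_inv, norm_multiplier hε, inv_one, mul_one]
      exact (Finsupp.equivCongrLeft σ).summable_iff.2 (isExpansion_coeff g).summable
    have hf : IsExpansion a fun z => ∑' α, a α * monom α z :=
      ⟨ha, fun z => (summable_norm_mul_monom ha z).of_norm.hasSum⟩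
    refine ⟨⟨_, a, hf⟩, Subtype.ext (funext fun z => ?_)⟩
    have hexp : IsExpansion (coeff g) (compOp φ hC ⟨_, a, hf⟩).1 :=
      IsExpansion.comp_weightedPerm hε hφ (fun _ => rfl) hf
    exact (hexp.hasSum z).unique ((isExpansion_coeff g).hasSum z)
  exact ⟨AlgEquiv.ofBijective _ ⟨hinj, hsurj⟩, rfl⟩

end WeightedPermutation

/-! ### Rigidity by the Schwarz lemma -/

section Rigidity

variable {φ : C0 → C0}

theorem differentiableOn_apply_smul (hφ : AnalyticOnNhd ℂ φ B) (k : ℕ) {v : C0} (hv : ‖v‖ = 1) :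
    DifferentiableOn ℂ (fun w : ℂ => φ (w • v) k) (ball 0 1) := by
  intro w hw
  have h1 : DifferentiableAt ℂ φ (w • v) :=
    (hφ _ (smul_mem_B hv (mem_ball_zero_iff.1 hw))).differentiableAt
  have h2 : DifferentiableAt ℂ (fun w : ℂ => w • v) w := by fun_prop
  exact ((coordCLM k).differentiableAt.comp w (h1.comp w h2)).differentiableWithinAt

/-- The derivative at the origin along a line of a function of the form `z k ^ d * u z`. -/
theorem hasDerivAt_line {f u : C0 → ℂ} {k d : ℕ} (hd : 1 ≤ d) (hu : ContinuousOn u B)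
    (hf : ∀ z ∈ B, f z = z k ^ d * u z) {v : C0} (hv : ‖v‖ = 1) :
    HasDerivAt (fun w : ℂ => f (w • v)) (0 ^ (d - 1) * (v k ^ d * u 0)) 0 := by
  -- With `d = m + 1` the difference quotient is `w ^ m * (v k ^ d * u (w • v))`, so continuity of
  -- `u` at the origin suffices. The convention `0 ^ 0 = 1` covers `d = 1`.
  obtain ⟨m, rfl⟩ := Nat.exists_eq_add_of_le' hd
  have hf0 : f 0 = 0 := by rw [hf 0 zero_mem_B]; simp
  rw [hasDerivAt_iff_tendsto_slope_zero]
  have hline : Tendsto (fun w : ℂ => w • v) (𝓝 0) (𝓝 0) := by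
    have : Continuous fun w : ℂ => w • v := by fun_prop
    simpa using this.tendsto 0
  have hcont : Tendsto u (𝓝 0) (𝓝 (u 0)) := hu.continuousAt (isOpen_ball.mem_nhds zero_mem_B)
  have hlim : Tendsto (fun w : ℂ => w ^ m * (v k ^ (m + 1) * u (w • v))) (𝓝[≠] 0)
      (𝓝 (0 ^ m * (v k ^ (m + 1) * u 0))) :=
    (((continuous_pow m).tendsto (0 : ℂ)).mul ((hcont.comp hline).const_mul _)).mono_left
      nhdsWithin_le_nhds
  refine hlim.congr' ?_
  filter_upwards [self_mem_nhdsWithin, mem_nhdsWithin_of_mem_nhds (ball_mem_nhds (0 : ℂ) one_pos)]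
    with w hw hw1
  have hw0 : w ≠ 0 := hw
  simp only [zero_add, zero_smul, hf0, sub_zero, smul_eq_mul]
  rw [hf _ (smul_mem_B hv (mem_ball_zero_iff.1 hw1)), ZeroAtInftyContinuousMap.smul_apply,
    smul_eq_mul]
  field_simp
  ring

/-- If `C_φ` has a right inverse among the algebra endomorphisms and `φ` fixes the origin and
preserves the `k`-th coordinate axis, then it preserves the norm on this axis. -/
theorem norm_apply_smul_basisVec (hφ : AnalyticOnNhd ℂ φ B) (hB : Set.MapsTo φ B B)
    (T : wienerAlgebra →ₐ[ℂ] wienerAlgebra) (k : ℕ)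
    (hT : ∀ z : B, (T (coord k)).1 (hB.restrict φ B B z) = (z : C0) k) (h0 : φ 0 = 0)
    (haxis : ∀ w : ℂ, ‖w‖ < 1 → ∀ j, j ≠ k → φ (w • basisVec k) j = 0) {w : ℂ} (hw : ‖w‖ < 1) :
    ‖φ (w • basisVec k) k‖ = ‖w‖ := by
  have hv := norm_basisVec k
  have hwB := smul_mem_B hv hw
  -- Schwarz lemma for `φ` as a self-map of the ball of `c₀`.
  have hle : ‖φ (w • basisVec k) k‖ ≤ ‖w‖ := by
    refine (norm_apply_le _ k).trans ?_
    have h := Complex.norm_le_norm_of_mapsTo_ball (R := 1) hφ.differentiableOn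
      (hB.mono_right ball_subset_closedBall) h0 (mem_B_iff.1 hwB)
    rwa [norm_smul, hv, mul_one] at h
  obtain ⟨h, hd, hh⟩ := exists_differentiableOn_line (T (coord k)) hv
  have hmaps : Set.MapsTo h (ball 0 1) (closedBall 0 1) := fun x hx => by
    rw [mem_closedBall_zero_iff, hh x (mem_ball_zero_iff.1 hx)]
    exact norm_map_coord_le_one T k _
  -- A point of the image of the axis is its `k`-th coordinate times `e_k`, so `h`, the restriction
  -- of `T (coord k)` to the axis, inverts `φ k` there.
  have key : ∀ x : ℂ, ‖x‖ < 1 → ∀ hx : ‖φ (x • basisVec k) k‖ < 1,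
      h (φ (x • basisVec k) k) = x := by
    intro x hx1 hx
    rw [hh _ hx]
    have e : (⟨φ (x • basisVec k) k • basisVec k, smul_mem_B hv hx⟩ : B) =
        hB.restrict φ B B ⟨x • basisVec k, smul_mem_B hv hx1⟩ :=
      Subtype.ext (eq_smul_basisVec (haxis x hx1)).symm
    rw [e, hT]
    simp [basisVec_self]
  have hh0 : h 0 = 0 := by
    have := key 0 (by simp) (by simp [h0])
    simpa [h0] using this
  have hlt := hle.trans_lt hw
  -- Schwarz lemma for the left inverse `h`, giving the opposite inequality.
  have h2 := Complex.norm_le_norm_of_mapsTo_ball hd hmaps hh0 hlt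
  rw [key w hw hlt] at h2
  exact le_antisymm hle h2

theorem norm_deriv_eq_one_of_norm_eq {g : ℂ → ℂ} {c : ℂ} (hg : HasDerivAt g c 0)
    (h : ∀ w : ℂ, ‖w‖ < 1 → ‖g w‖ = ‖w‖) : ‖c‖ = 1 := by
  have hg0 : g 0 = 0 := norm_eq_zero.1 (by rw [h 0 (by simp), norm_zero])
  rw [hasDerivAt_iff_tendsto_slope_zero] at hg
  refine tendsto_nhds_unique hg.norm (tendsto_const_nhds.congr' ?_)
  filter_upwards [self_mem_nhdsWithin, mem_nhdsWithin_of_mem_nhds (ball_mem_nhds (0 : ℂ) one_pos)]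
    with w hw hw1
  have hw0 : ‖w‖ ≠ 0 := norm_ne_zero_iff.2 hw
  rw [zero_add, hg0, sub_zero, norm_smul, h w (mem_ball_zero_iff.1 hw1), norm_inv,
    inv_mul_cancel₀ hw0]

/-- The equality case of the Schwarz lemma on the lines on which the `k`-th coordinate has
maximal modulus. -/
theorem apply_eq_of_norm_apply_eq_norm (hφ : AnalyticOnNhd ℂ φ B) (hB : Set.MapsTo φ B B)
    (h0 : φ 0 = 0) {k : ℕ} {c : ℂ} (hc : ‖c‖ = 1)
    (hderiv : ∀ v : C0, ‖v‖ = 1 → HasDerivAt (fun w : ℂ => φ (w • v) k) (c * v k) 0)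
    {z : C0} (hz : z ∈ B) (hzk : ‖z k‖ = ‖z‖) : φ z k = c * z k := by
  rcases eq_or_ne z 0 with rfl | hne
  · simp [h0]
  have hnorm : ‖z‖ ≠ 0 := norm_ne_zero_iff.2 hne
  have hnorm' : (‖z‖ : ℂ) ≠ 0 := Complex.ofReal_ne_zero.2 hnorm
  have hn : ‖(‖z‖ : ℂ)‖ = ‖z‖ := by simp
  set v : C0 := (‖z‖ : ℂ)⁻¹ • z with hv_def
  have hv : ‖v‖ = 1 := by rw [hv_def, norm_smul, norm_inv, hn, inv_mul_cancel₀ hnorm]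
  have hvk : v k = (‖z‖ : ℂ)⁻¹ * z k := rfl
  have hzv : (‖z‖ : ℂ) • v = z := smul_inv_smul₀ hnorm' z
  have hg0 : φ ((0 : ℂ) • v) k = 0 := by simp [h0]
  -- Since `|z k| = ‖z‖`, the direction `v` has `|v k| = 1`, and the derivative `c * v k` attains
  -- the Schwarz bound.
  have hdv : ‖dslope (fun w : ℂ => φ (w • v) k) 0 0‖ = 1 / 1 := by
    rw [dslope_same, (hderiv v hv).deriv, norm_mul, hc, hvk, norm_mul, norm_inv, hn, hzk,
      inv_mul_cancel₀ hnorm]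
    norm_num
  have h := Complex.affine_of_mapsTo_ball_of_norm_dslope_eq_div
    (differentiableOn_apply_smul hφ k hv) (fun w hw => by
      rw [hg0, mem_closedBall_zero_iff]
      exact (norm_apply_lt_one
        ⟨_, hB (smul_mem_B hv (mem_ball_zero_iff.1 hw))⟩ k).le) (mem_ball_self one_pos) hdv
  have hzb : (‖z‖ : ℂ) ∈ ball (0 : ℂ) 1 := by
    rw [mem_ball_zero_iff, hn]
    exact mem_B_iff.1 hz
  have h' := h hzb
  simp only [hg0, hzv, zero_add, sub_zero, smul_eq_mul, dslope_same,
    (hderiv v hv).deriv, hvk] at h'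
  rw [h']
  field_simp

/-- Within `1/4` of `e_k / 2`, the `k`-th coordinate has modulus at least `1/4` and all others less.
This supplies the open set for the identity theorem. -/
theorem eventually_norm_apply_eq_norm (k : ℕ) :
    ∀ᶠ z in 𝓝 ((1 / 2 : ℂ) • basisVec k), ‖z k‖ = ‖z‖ := by
  filter_upwards [ball_mem_nhds _ (show (0 : ℝ) < 1 / 4 by norm_num)] with z hz
  rw [mem_ball_iff_norm] at hz
  have hj : ∀ j, ‖z j - (1 / 2 : ℂ) * basisVec k j‖ < 1 / 4 := fun j =>
    (norm_apply_le (z - (1 / 2 : ℂ) • basisVec k) j).trans_lt hz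
  have hk : 1 / 4 ≤ ‖z k‖ := by
    have h1 := hj k
    rw [basisVec_self, mul_one] at h1
    have h2 := norm_sub_norm_le (1 / 2 : ℂ) (z k)
    rw [norm_sub_rev] at h2
    have h3 : ‖(1 / 2 : ℂ)‖ = 1 / 2 := by norm_num
    linarith
  refine le_antisymm (norm_apply_le z k) (norm_le_of_forall (norm_nonneg _) fun j => ?_)
  rcases eq_or_ne j k with rfl | hjk
  · exact le_rfl
  · have h1 := hj j
    rw [basisVec_of_ne hjk, mul_zero, sub_zero] at h1
    exact h1.le.trans hk

theorem apply_eq_mul_of_hasDerivAt (hφ : AnalyticOnNhd ℂ φ B) (hB : Set.MapsTo φ B B)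
    (h0 : φ 0 = 0) {k : ℕ} {c : ℂ} (hc : ‖c‖ = 1)
    (hderiv : ∀ v : C0, ‖v‖ = 1 → HasDerivAt (fun w : ℂ => φ (w • v) k) (c * v k) 0)
    {z : C0} (hz : z ∈ B) : φ z k = c * z k := by
  have h1 : AnalyticOnNhd ℂ (fun z => φ z k) B := (coordCLM k).comp_analyticOnNhd hφ
  have h2 : AnalyticOnNhd ℂ (fun z : C0 => c * z k) B := fun x _ =>
    analyticAt_const.mul ((coordCLM k).analyticAt x)
  have hmem : (1 / 2 : ℂ) • basisVec k ∈ B := smul_mem_B (norm_basisVec k) (by norm_num)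
  refine h1.eqOn_of_preconnected_of_eventuallyEq h2 (convex_ball _ _).isPreconnected hmem ?_ hz
  filter_upwards [eventually_norm_apply_eq_norm k, isOpen_ball.mem_nhds hmem] with y hy hyB
  exact apply_eq_of_norm_apply_eq_norm hφ hB h0 hc hderiv hyB hy

theorem exists_eq_mul_of_isAutomorphism (hφ : AnalyticOnNhd ℂ φ B) (hB : Set.MapsTo φ B B)
    (hC : MapsWienerAlgebra (hB.restrict φ B B)) (haut : IsAutomorphism (compOp _ hC))
    {d : ℕ → ℕ} {u : ℕ → C0 → ℂ} (hd : ∀ k, 1 ≤ d k) (hu : ∀ k, ContinuousOn (u k) B)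
    (h : ∀ k, ∀ z ∈ B, φ z k = z k ^ d k * u k z) (k : ℕ) :
    ∃ c : ℂ, ‖c‖ = 1 ∧ ∀ z ∈ B, φ z k = c * z k := by
  obtain ⟨e, he⟩ := haut
  have hT : ∀ z : B, ((e.symm : wienerAlgebra →ₐ[ℂ] wienerAlgebra) (coord k)).1
      (hB.restrict φ B B z) = (z : C0) k := fun z => by
    have h1 : compOp _ hC (e.symm (coord k)) = coord k := by
      rw [← he]
      exact e.apply_symm_apply _
    exact congrFun (congrArg Subtype.val h1) z
  have hvanish : ∀ j, ∀ z ∈ B, z j = 0 → φ z j = 0 := fun j z hz hzj => by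
    rw [h j z hz, hzj, zero_pow (Nat.one_le_iff_ne_zero.1 (hd j)), zero_mul]
  have h0 : φ 0 = 0 := ZeroAtInftyContinuousMap.ext fun j => hvanish j 0 zero_mem_B rfl
  have haxis : ∀ w : ℂ, ‖w‖ < 1 → ∀ j, j ≠ k → φ (w • basisVec k) j = 0 := fun w hw j hj =>
    hvanish j _ (smul_mem_B (norm_basisVec k) hw) (by simp [basisVec_of_ne hj])
  have hder := fun (v : C0) (hv : ‖v‖ = 1) =>
    hasDerivAt_line (f := fun z => φ z k) (hd k) (hu k) (h k) hv
  have hc : ‖(0 : ℂ) ^ (d k - 1) * u k 0‖ = 1 := by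
    have h1 := norm_deriv_eq_one_of_norm_eq (hder _ (norm_basisVec k)) fun w hw =>
      norm_apply_smul_basisVec hφ hB _ k hT h0 haxis hw
    simpa [basisVec_self] using h1
  -- If `d k > 1`, the derivative on the axis would vanish instead of being unimodular.
  have hdk : d k = 1 := by
    by_contra hne
    have : d k - 1 ≠ 0 := by have := hd k; omega
    simp [zero_pow this] at hc
  refine ⟨u k 0, by simpa [hdk] using hc, fun z hz =>
    apply_eq_mul_of_hasDerivAt hφ hB h0 (by simpa [hdk] using hc) (fun v hv => ?_) hz⟩
  simpa [hdk, mul_comm] using hder v hv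

end Rigidity

end WienerPolydisc

theorem theorem3p2 (φ : WienerPolydisc.C0 → WienerPolydisc.C0)
    (hφ : AnalyticOnNhd ℂ φ WienerPolydisc.B)
    (hB : Set.MapsTo φ WienerPolydisc.B WienerPolydisc.B)
    (hC : WienerPolydisc.MapsWienerAlgebra (hB.restrict φ WienerPolydisc.B WienerPolydisc.B)) :
    -- (a)
    ((∃ (σ : Equiv.Perm ℕ) (ε : ℕ → ℂ), (∀ j, ‖ε j‖ = 1) ∧
        ∀ z ∈ WienerPolydisc.B, ∀ j, φ z j = ε j * z (σ j)) →
      WienerPolydisc.IsAutomorphism (WienerPolydisc.compOp _ hC) ∧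
        WienerPolydisc.IsIsometric (WienerPolydisc.compOp _ hC)) ∧
    -- (b)
    (WienerPolydisc.IsAutomorphism (WienerPolydisc.compOp _ hC) →
      (∃ (d : ℕ → ℕ) (u : ℕ → WienerPolydisc.C0 → ℂ),
        (∀ k, 1 ≤ d k ∧ ContinuousOn (u k) WienerPolydisc.B ∧ u k 0 ≠ 0) ∧
        ∀ k, ∀ z ∈ WienerPolydisc.B, φ z k = z k ^ d k * u k z) →
      ∃ ε : ℕ → ℂ, (∀ j, ‖ε j‖ = 1) ∧
        ∀ z ∈ WienerPolydisc.B, ∀ j, φ z j = ε j * z j) := by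
  refine ⟨?_, ?_⟩
  · rintro ⟨σ, ε, hε, h⟩
    have h' : ∀ z : WienerPolydisc.B, ∀ j,
        (hB.restrict φ WienerPolydisc.B WienerPolydisc.B z : WienerPolydisc.C0) j =
          ε j * (z : WienerPolydisc.C0) (σ j) := fun z => h z z.2
    exact ⟨WienerPolydisc.isAutomorphism_compOp_of_weightedPerm hε h' hC,
      WienerPolydisc.isIsometric_compOp_of_weightedPerm hε h' hC⟩
  · rintro haut ⟨d, u, hdu, h⟩
    choose ε hε hεφ using WienerPolydisc.exists_eq_mul_of_isAutomorphism hφ hB hC haut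
      (fun k => (hdu k).1) (fun k => (hdu k).2.1) h
    exact ⟨ε, hε, fun z hz j => hεφ j z hz⟩
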